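/- A complex $*$-algebra $A$ is called \emph{symmetric} if the spectrum $\mathrm{Sp}_A(a^*a)$ (taken in the unitization of $A$ if $A$ is not unital) is contained in $[0,\infty)$ for every $a\in A$. For Banach $*$-algebras $A$ and $B$ with isometric involutions, let $A\otimes_\gamma B$ be the Banach space projective tensor product, i.e. the completion of the algebraic tensor product for the norm $\|t\|=\inf\{\sum_i\|a_i\|\|b_i\| : t=\sum_i a_i\otimes b_i\}$, which is a Banach $*$-algebra with $(a\otimes b)(a'\otimes b')=aa'\otimes bb'$ and $(a\otimes b)^*=a^*\otimes b^*$. A Banach $*$-algebra $A$ is called \emph{rigidly symmetric} if $A\otimes_\gamma B$ is symmetric for every C*-algebra $B$. Let $\mathbb F_2$ be the free group on two generators, let $\lambda$ be its left regular representation on $\ell^2(\mathbb F_2)$, let $\mathrm C^*_{\mathrm r}(\mathbb F_2)\subset \mathrm B(\ell^2(\mathbb F_2))$ be its reduced C*-algebra (the norm closure of the linear span of the operators $\lambda(s)$), and let $\ell^1(\mathbb F_2)$ be the Banach $*$-algebra with convolution product $(f*g)(t)=\sum_s f(s)g(s^{-1}t)$ and involution $f^*(t)=\overline{f(t^{-1})}$.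 Then the following hold. (1) The diagonal embedding $$\ell^1(\mathbb F_2)\ni f\mapsto \sum_{s\in\mathbb F_2} f(s)\,\big(\lambda(s)\otimes\lambda(s)\big)\in \mathrm C^*_{\mathrm r}(\mathbb F_2)\otimes_\gamma \mathrm C^*_{\mathrm r}(\mathbb F_2)$$ is well defined (the sum converges unconditionally in norm) and is an isometric $*$-homomorphism. (2) $\ell^1(\mathbb F_2)$ is not symmetric. (3) $\mathrm C^*_{\mathrm r}(\mathbb F_2)\otimes_\gamma \mathrm C^*_{\mathrm r}(\mathbb F_2)$ is not symmetric. (4) $\mathrm C^*_{\mathrm r}(\mathbb F_2)$ is a symmetric Banach $*$-algebra that is not rigidly symmetric. -/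

import Mathlib

open scoped TensorProduct ENNReal

set_option linter.unusedSectionVars false

noncomputable section

/-! ### Symmetric `*`-algebras -/

/-- A complex `*`-algebra `A` is symmetric if the spectrum of `a* a` is contained in `[0, ∞)` for
all `a`. As `A` need not be unital, the spectrum is `quasispectrum ℂ`, i.e. the spectrum in the
unitization of `A`. If `A` is unital, this is the usual spectrum with the point `0` adjoined, so
that the condition is the same for the usual spectrum
(see `isSymmetricStarAlgebra_iff_spectrum`). -/
def IsSymmetricStarAlgebra (A : Type*) [NonUnitalRing A] [Star A] [Module ℂ A] : Prop :=
  ∀ a : A, quasispectrum ℂ (star a * a) ⊆ (fun r : ℝ => (r : ℂ)) '' Set.Ici 0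

theorem isSymmetricStarAlgebra_iff_spectrum (A : Type*) [Ring A] [Star A] [Algebra ℂ A] :
    IsSymmetricStarAlgebra A ↔
      ∀ a : A, spectrum ℂ (star a * a) ⊆ (fun r : ℝ => (r : ℂ)) '' Set.Ici 0 := by
  refine forall_congr' fun a => ?_
  rw [quasispectrum_eq_spectrum_union_zero, Set.union_subset_iff]
  exact ⟨fun h => h.1, fun h => ⟨h, by rintro _ rfl; exact ⟨0, by simp⟩⟩⟩

/-! ### The projective tensor product of Banach spaces -/

/-- The algebraic tensor product of two complex normed spaces, to be endowed with the projective
seminorm. -/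
def AlgProjTensor (X Y : Type*) [NormedAddCommGroup X] [NormedSpace ℂ X]
    [NormedAddCommGroup Y] [NormedSpace ℂ Y] : Type _ := X ⊗[ℂ] Y

namespace AlgProjTensor

section Space

variable (X Y : Type*) [NormedAddCommGroup X] [NormedSpace ℂ X]
  [NormedAddCommGroup Y] [NormedSpace ℂ Y]

instance instAddCommGroup : AddCommGroup (AlgProjTensor X Y) :=
  inferInstanceAs (AddCommGroup (X ⊗[ℂ] Y))

instance instModule : Module ℂ (AlgProjTensor X Y) :=
  inferInstanceAs (Module ℂ (X ⊗[ℂ] Y))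

variable {X Y}

/-- The elementary tensor `x ⊗ y`. -/
def tmul (x : X) (y : Y) : AlgProjTensor X Y := x ⊗ₜ[ℂ] y

/-- The tensor `∑ xᵢ ⊗ yᵢ` represented by the finite list of the `(xᵢ, yᵢ)`. -/
def ofList (l : List (X × Y)) : AlgProjTensor X Y := (l.map fun p => tmul p.1 p.2).sum

/-- The cost `∑ ‖xᵢ‖ ‖yᵢ‖` of the finite list of the `(xᵢ, yᵢ)`. -/
def cost (l : List (X × Y)) : ℝ := (l.map fun p => ‖p.1‖ * ‖p.2‖).sum

/-- The projective norm `‖t‖ = inf {∑ ‖xᵢ‖ ‖yᵢ‖ : t = ∑ xᵢ ⊗ yᵢ}`. -/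
def projNorm (t : AlgProjTensor X Y) : ℝ :=
  sInf {r : ℝ | ∃ l : List (X × Y), t = ofList l ∧ r = cost l}

theorem ofList_append (l m : List (X × Y)) : ofList (l ++ m) = ofList l + ofList m := by
  simp [ofList]

theorem cost_append (l m : List (X × Y)) : cost (l ++ m) = cost l + cost m := by
  simp [cost]

theorem cost_nonneg (l : List (X × Y)) : 0 ≤ cost l := by
  refine List.sum_nonneg fun r hr => ?_
  obtain ⟨p, -, rfl⟩ := List.mem_map.1 hr
  positivity

@[elab_as_elim]
theorem induction {p : AlgProjTensor X Y → Prop} (t : AlgProjTensor X Y) (zero : p 0)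
    (tmul : ∀ x y, p (tmul x y)) (add : ∀ s t, p s → p t → p (s + t)) : p t :=
  TensorProduct.induction_on (motive := p) t zero tmul add

theorem exists_ofList (t : AlgProjTensor X Y) : ∃ l : List (X × Y), t = ofList l := by
  induction t using AlgProjTensor.induction with
  | zero => exact ⟨[], rfl⟩
  | tmul x y => exact ⟨[(x, y)], by simp [ofList]⟩
  | add s t hs ht =>
    obtain ⟨l, rfl⟩ := hs
    obtain ⟨m, rfl⟩ := ht
    exact ⟨l ++ m, (ofList_append l m).symm⟩

theorem projNorm_ofList_le (l : List (X × Y)) : projNorm (ofList l) ≤ cost l :=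
  csInf_le ⟨0, by rintro _ ⟨m, -, rfl⟩; exact cost_nonneg m⟩ ⟨l, rfl, rfl⟩

theorem projNorm_nonneg (t : AlgProjTensor X Y) : 0 ≤ projNorm t :=
  Real.sInf_nonneg (by rintro _ ⟨m, -, rfl⟩; exact cost_nonneg m)

theorem exists_cost_lt (t : AlgProjTensor X Y) {ε : ℝ} (hε : 0 < ε) :
    ∃ l : List (X × Y), t = ofList l ∧ cost l < projNorm t + ε := by
  obtain ⟨l₀, h₀⟩ := exists_ofList t
  obtain ⟨_, ⟨l, hl, rfl⟩, h⟩ :=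
    Real.lt_sInf_add_pos (s := {r : ℝ | ∃ l : List (X × Y), t = ofList l ∧ r = cost l})
      ⟨_, l₀, h₀, rfl⟩ hε
  exact ⟨l, hl, h⟩

theorem smul_ofList (c : ℂ) (l : List (X × Y)) :
    c • ofList l = ofList (l.map fun p => (c • p.1, p.2)) := by
  induction l with
  | nil => simp [ofList]
  | cons p l ih =>
    simp only [ofList, List.map_cons, List.sum_cons, smul_add] at ih ⊢
    rw [ih]
    rfl

theorem cost_smul (c : ℂ) (l : List (X × Y)) :
    cost (l.map fun p => (c • p.1, p.2)) = ‖c‖ * cost l := by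
  induction l with
  | nil => simp [cost]
  | cons p l ih =>
    simp only [cost, List.map_cons, List.sum_cons, mul_add, norm_smul] at ih ⊢
    rw [ih, mul_assoc]

theorem projNorm_smul_le (c : ℂ) (t : AlgProjTensor X Y) :
    projNorm (c • t) ≤ ‖c‖ * projNorm t := by
  refine le_of_forall_pos_le_add fun ε hε => ?_
  obtain ⟨l, hl, h⟩ := exists_cost_lt t (ε := ε / (‖c‖ + 1)) (by positivity)
  have h1 : projNorm (c • t) ≤ ‖c‖ * cost l := by
    rw [hl, smul_ofList, ← cost_smul]
    exact projNorm_ofList_le _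
  have h2 : ‖c‖ * (ε / (‖c‖ + 1)) ≤ ε := by
    rw [← mul_div_assoc, div_le_iff₀ (by positivity)]
    nlinarith [norm_nonneg c]
  nlinarith [mul_le_mul_of_nonneg_left h.le (norm_nonneg c)]

theorem projNorm_add_le (s t : AlgProjTensor X Y) : projNorm (s + t) ≤ projNorm s + projNorm t := by
  refine le_of_forall_pos_le_add fun ε hε => ?_
  obtain ⟨l, hl, h⟩ := exists_cost_lt s (half_pos hε)
  obtain ⟨m, hm, h'⟩ := exists_cost_lt t (half_pos hε)
  have : projNorm (s + t) ≤ cost l + cost m := by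
    rw [hl, hm, ← ofList_append, ← cost_append]
    exact projNorm_ofList_le _
  linarith

theorem projNorm_zero : projNorm (0 : AlgProjTensor X Y) = 0 :=
  le_antisymm (projNorm_ofList_le []) (projNorm_nonneg _)

instance instSeminormedAddCommGroup : SeminormedAddCommGroup (AlgProjTensor X Y) :=
  AddGroupSeminorm.toSeminormedAddCommGroup
    { toFun := projNorm
      map_zero' := projNorm_zero
      add_le' := projNorm_add_le
      neg' := (Seminorm.ofSMulLE (𝕜 := ℂ) projNorm projNorm_zero projNorm_add_le
        projNorm_smul_le).neg' }

theorem norm_def (t : AlgProjTensor X Y) : ‖t‖ = projNorm t := rfl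

instance instNormedSpace : NormedSpace ℂ (AlgProjTensor X Y) := ⟨projNorm_smul_le⟩

end Space

section Algebra

variable {A B : Type*}
  [NonUnitalNormedRing A] [NormedSpace ℂ A] [IsScalarTower ℂ A A] [SMulCommClass ℂ A A]
  [NonUnitalNormedRing B] [NormedSpace ℂ B] [IsScalarTower ℂ B B] [SMulCommClass ℂ B B]

instance instNonUnitalRing : NonUnitalRing (AlgProjTensor A B) :=
  { instAddCommGroup A B with
    mul := fun s t => (Algebra.TensorProduct.instMul (R := ℂ) (A := A) (B := B)).mul s t
    left_distrib := fun s t u => mul_add (R := A ⊗[ℂ] B) s t u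
    right_distrib := fun s t u => add_mul (R := A ⊗[ℂ] B) s t u
    zero_mul := fun s => zero_mul (M₀ := A ⊗[ℂ] B) s
    mul_zero := fun s => mul_zero (M₀ := A ⊗[ℂ] B) s
    mul_assoc := fun s t u => mul_assoc (G := A ⊗[ℂ] B) s t u }

instance instIsScalarTower : IsScalarTower ℂ (AlgProjTensor A B) (AlgProjTensor A B) :=
  ⟨fun c s t => smul_mul_assoc (β := A ⊗[ℂ] B) c s t⟩

instance instSMulCommClass : SMulCommClass ℂ (AlgProjTensor A B) (AlgProjTensor A B) :=
  ⟨fun c s t => (mul_smul_comm (β := A ⊗[ℂ] B) c s t).symm⟩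

theorem tmul_mul_tmul (a a' : A) (b b' : B) :
    (tmul a b * tmul a' b' : AlgProjTensor A B) = tmul (a * a') (b * b') :=
  Algebra.TensorProduct.tmul_mul_tmul (R := ℂ) a a' b b'

theorem tmul_mul_ofList (a : A) (b : B) (m : List (A × B)) :
    tmul a b * ofList m = ofList (m.map fun q => (a * q.1, b * q.2)) := by
  induction m with
  | nil => simp [ofList]
  | cons p l ih =>
    simp only [ofList, List.map_cons, List.sum_cons, mul_add] at ih ⊢
    rw [ih, tmul_mul_tmul]

theorem cost_mul_left_le (a : A) (b : B) (m : List (A × B)) :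
    cost (m.map fun q => (a * q.1, b * q.2)) ≤ ‖a‖ * ‖b‖ * cost m := by
  induction m with
  | nil => simp [cost]
  | cons p l ih =>
    simp only [cost, List.map_cons, List.sum_cons, mul_add] at ih ⊢
    refine add_le_add ?_ ih
    calc ‖a * p.1‖ * ‖b * p.2‖ ≤ (‖a‖ * ‖p.1‖) * (‖b‖ * ‖p.2‖) := by
          gcongr <;> exact norm_mul_le _ _
      _ = _ := by ring

theorem projNorm_ofList_mul_le (l m : List (A × B)) :
    projNorm (ofList l * ofList m) ≤ cost l * cost m := by
  induction l with
  | nil => simp [ofList, cost, projNorm_zero]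
  | cons p l ih =>
    have h1 : ofList (p :: l) = tmul p.1 p.2 + ofList l := by simp [ofList]
    have h2 : cost (p :: l) = ‖p.1‖ * ‖p.2‖ + cost l := by simp [cost]
    rw [h1, h2, add_mul, add_mul]
    refine (projNorm_add_le _ _).trans (add_le_add ?_ ih)
    rw [tmul_mul_ofList]
    exact (projNorm_ofList_le _).trans (cost_mul_left_le _ _ _)

theorem projNorm_mul_le (s t : AlgProjTensor A B) :
    projNorm (s * t) ≤ projNorm s * projNorm t := by
  have key : ∀ ε : ℝ, 0 < ε → projNorm (s * t) ≤ (projNorm s + ε) * (projNorm t + ε) := by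
    intro ε hε
    obtain ⟨l, hl, h⟩ := exists_cost_lt s hε
    obtain ⟨m, hm, h'⟩ := exists_cost_lt t hε
    calc projNorm (s * t) ≤ cost l * cost m := by
          rw [hl, hm]
          exact projNorm_ofList_mul_le l m
      _ ≤ _ := mul_le_mul h.le h'.le (cost_nonneg m) (by linarith [projNorm_nonneg s])
  have hlim : Filter.Tendsto (fun ε : ℝ => (projNorm s + ε) * (projNorm t + ε))
      (nhdsWithin 0 (Set.Ioi 0)) (nhds ((projNorm s + 0) * (projNorm t + 0))) := by
    refine Filter.Tendsto.mono_left ?_ nhdsWithin_le_nhds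
    exact Continuous.tendsto (by fun_prop) 0
  rw [add_zero, add_zero] at hlim
  exact ge_of_tendsto hlim (Filter.eventually_of_mem self_mem_nhdsWithin fun ε hε => key ε hε)

instance instNonUnitalSeminormedRing : NonUnitalSeminormedRing (AlgProjTensor A B) :=
  { instSeminormedAddCommGroup (X := A) (Y := B), instNonUnitalRing (A := A) (B := B) with
    norm_mul_le := projNorm_mul_le }

end Algebra

section Star

variable {A B : Type*}
  [NonUnitalNormedRing A] [StarRing A] [NormedStarGroup A]
  [NormedSpace ℂ A] [IsScalarTower ℂ A A] [SMulCommClass ℂ A A] [StarModule ℂ A]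
  [NonUnitalNormedRing B] [StarRing B] [NormedStarGroup B]
  [NormedSpace ℂ B] [IsScalarTower ℂ B B] [SMulCommClass ℂ B B] [StarModule ℂ B]

instance instStarAddMonoid : StarAddMonoid (AlgProjTensor A B) :=
  inferInstanceAs (StarAddMonoid (A ⊗[ℂ] B))

theorem star_tmul (a : A) (b : B) : star (tmul a b) = tmul (star a) (star b) := rfl

instance instStarRing : StarRing (AlgProjTensor A B) where
  star_add := star_add
  star_mul s t := by
    induction s using AlgProjTensor.induction with
    | zero => simp
    | add s₁ s₂ h₁ h₂ => simp only [add_mul, mul_add, star_add, h₁, h₂]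
    | tmul a b =>
      induction t using AlgProjTensor.induction with
      | zero => simp
      | add s₁ s₂ h₁ h₂ => simp only [add_mul, mul_add, star_add, h₁, h₂]
      | tmul a' b' => simp only [tmul_mul_tmul, star_tmul, star_mul]

instance instStarModule : StarModule ℂ (AlgProjTensor A B) :=
  inferInstanceAs (StarModule ℂ (A ⊗[ℂ] B))

theorem star_ofList (l : List (A × B)) :
    star (ofList l) = ofList (l.map fun p => (star p.1, star p.2)) := by
  induction l with
  | nil => simp [ofList]
  | cons p l ih =>
    simp only [ofList, List.map_cons, List.sum_cons, star_add] at ih ⊢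
    rw [ih, star_tmul]

theorem cost_star (l : List (A × B)) :
    cost (l.map fun p => (star p.1, star p.2)) = cost l := by
  simp [cost, Function.comp_def]

theorem projNorm_star_le (t : AlgProjTensor A B) : projNorm (star t) ≤ projNorm t := by
  refine le_of_forall_pos_le_add fun ε hε => ?_
  obtain ⟨l, hl, h⟩ := exists_cost_lt t hε
  refine le_trans ?_ h.le
  rw [hl, star_ofList, ← cost_star l]
  exact projNorm_ofList_le _

instance instNormedStarGroup : NormedStarGroup (AlgProjTensor A B) := ⟨projNorm_star_le⟩

end Star

end AlgProjTensor

/-- The projective tensor product `X ⊗_γ Y` of two Banach spaces: the completion of the algebraic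
tensor product for the projective norm. -/
def ProjectiveTensor (X Y : Type*) [NormedAddCommGroup X] [NormedSpace ℂ X]
    [NormedAddCommGroup Y] [NormedSpace ℂ Y] : Type _ :=
  UniformSpace.Completion (AlgProjTensor X Y)

namespace ProjectiveTensor

open UniformSpace

section Space

variable (X Y : Type*) [NormedAddCommGroup X] [NormedSpace ℂ X]
  [NormedAddCommGroup Y] [NormedSpace ℂ Y]

instance instNormedAddCommGroup : NormedAddCommGroup (ProjectiveTensor X Y) :=
  inferInstanceAs (NormedAddCommGroup (Completion (AlgProjTensor X Y)))

instance instNormedSpace : NormedSpace ℂ (ProjectiveTensor X Y) :=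
  inferInstanceAs (NormedSpace ℂ (Completion (AlgProjTensor X Y)))

instance instCompleteSpace : CompleteSpace (ProjectiveTensor X Y) :=
  inferInstanceAs (CompleteSpace (Completion (AlgProjTensor X Y)))

variable {X Y}

/-- The canonical map of the algebraic tensor product into the projective one. -/
def ofAlg : AlgProjTensor X Y →ₗᵢ[ℂ] ProjectiveTensor X Y := Completion.toComplₗᵢ

/-- The elementary tensor `x ⊗ y` in `X ⊗_γ Y`. -/
def tmul (x : X) (y : Y) : ProjectiveTensor X Y := ofAlg (AlgProjTensor.tmul x y)

theorem isDenseInducing_ofAlg : IsDenseInducing (ofAlg : AlgProjTensor X Y → ProjectiveTensor X Y) :=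
  Completion.isDenseInducing_coe

theorem denseRange_ofAlg : DenseRange (ofAlg : AlgProjTensor X Y → ProjectiveTensor X Y) :=
  isDenseInducing_ofAlg.dense

end Space

section Algebra

variable {A B : Type*}
  [NonUnitalNormedRing A] [NormedSpace ℂ A] [IsScalarTower ℂ A A] [SMulCommClass ℂ A A]
  [NonUnitalNormedRing B] [NormedSpace ℂ B] [IsScalarTower ℂ B B] [SMulCommClass ℂ B B]

/-- The multiplication of `A ⊗_γ B` is the continuous extension of the multiplication
`(a ⊗ b) (a' ⊗ b') = a a' ⊗ b b'` of the algebraic tensor product. -/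
instance instMul : Mul (ProjectiveTensor A B) where
  mul x y := (isDenseInducing_ofAlg.prodMap isDenseInducing_ofAlg).extend
    (fun p : AlgProjTensor A B × AlgProjTensor A B => ofAlg (p.1 * p.2)) (x, y)

theorem ofAlg_mul (s t : AlgProjTensor A B) : ofAlg (s * t) = ofAlg s * ofAlg t :=
  ((isDenseInducing_ofAlg.prodMap isDenseInducing_ofAlg).extend_eq
    (ofAlg.continuous.comp continuous_mul) (s, t)).symm

theorem continuous_mul' :
    Continuous fun p : ProjectiveTensor A B × ProjectiveTensor A B => p.1 * p.2 := by
  let i : AlgProjTensor A B →+ ProjectiveTensor A B := ofAlg.toLinearMap.toAddMonoidHom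
  let m := (AddMonoidHom.mul : AlgProjTensor A B →+ AlgProjTensor A B →+ AlgProjTensor A B).compr₂ i
  have hm : Continuous fun p : AlgProjTensor A B × AlgProjTensor A B => m p.1 p.2 :=
    ofAlg.continuous.comp continuous_mul
  have di : IsDenseInducing i := isDenseInducing_ofAlg
  exact di.extend_Z_bilin di hm

instance instContinuousMul : ContinuousMul (ProjectiveTensor A B) := ⟨continuous_mul'⟩

instance instNonUnitalNormedRing : NonUnitalNormedRing (ProjectiveTensor A B) :=
  { instNormedAddCommGroup A B, instMul (A := A) (B := B) with
    zero_mul x := by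
      refine denseRange_ofAlg.induction_on x (isClosed_eq (by fun_prop) (by fun_prop)) fun a => ?_
      rw [← map_zero ofAlg, ← ofAlg_mul, zero_mul]
    mul_zero x := by
      refine denseRange_ofAlg.induction_on x (isClosed_eq (by fun_prop) (by fun_prop)) fun a => ?_
      rw [← map_zero ofAlg, ← ofAlg_mul, mul_zero]
    mul_assoc x y z := by
      refine denseRange_ofAlg.induction_on₃ ?_ (fun a b c => ?_) x y z
      · exact isClosed_eq (by fun_prop) (by fun_prop)
      · simp only [← ofAlg_mul, mul_assoc]
    left_distrib x y z := by
      refine denseRange_ofAlg.induction_on₃ ?_ (fun a b c => ?_) x y z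
      · exact isClosed_eq (by fun_prop) (by fun_prop)
      · simp only [← ofAlg_mul, ← map_add, mul_add]
    right_distrib x y z := by
      refine denseRange_ofAlg.induction_on₃ ?_ (fun a b c => ?_) x y z
      · exact isClosed_eq (by fun_prop) (by fun_prop)
      · simp only [← ofAlg_mul, ← map_add, add_mul]
    norm_mul_le x y := by
      refine denseRange_ofAlg.induction_on₂ ?_ (fun a b => ?_) x y
      · exact isClosed_le (by fun_prop) (by fun_prop)
      · rw [← ofAlg_mul]
        simp only [LinearIsometry.norm_map]
        exact norm_mul_le a b }

instance instIsScalarTower : IsScalarTower ℂ (ProjectiveTensor A B) (ProjectiveTensor A B) where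
  smul_assoc c x y := by
    refine denseRange_ofAlg.induction_on₂ ?_ (fun a b => ?_) x y
    · exact isClosed_eq (((continuous_const_smul c).comp continuous_fst).mul continuous_snd)
        ((continuous_const_smul c).comp continuous_mul)
    · simp only [smul_eq_mul, ← ofAlg_mul, ← map_smul, smul_mul_assoc]

instance instSMulCommClass : SMulCommClass ℂ (ProjectiveTensor A B) (ProjectiveTensor A B) where
  smul_comm c x y := by
    refine denseRange_ofAlg.induction_on₂ ?_ (fun a b => ?_) x y
    · exact isClosed_eq ((continuous_const_smul c).comp continuous_mul)
        (continuous_fst.mul ((continuous_const_smul c).comp continuous_snd))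
    · simp only [smul_eq_mul, ← ofAlg_mul, ← map_smul, mul_smul_comm]

end Algebra

section Star

variable {A B : Type*}
  [NonUnitalNormedRing A] [StarRing A] [NormedStarGroup A]
  [NormedSpace ℂ A] [IsScalarTower ℂ A A] [SMulCommClass ℂ A A] [StarModule ℂ A]
  [NonUnitalNormedRing B] [StarRing B] [NormedStarGroup B]
  [NormedSpace ℂ B] [IsScalarTower ℂ B B] [SMulCommClass ℂ B B] [StarModule ℂ B]

/-- The involution of `A ⊗_γ B` is the continuous extension of the involution
`(a ⊗ b)* = a* ⊗ b*` of the algebraic tensor product. -/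
instance instStar : Star (ProjectiveTensor A B) where
  star := Completion.map (star : AlgProjTensor A B → AlgProjTensor A B)

theorem ofAlg_star (t : AlgProjTensor A B) : ofAlg (star t) = star (ofAlg t) :=
  (Completion.map_coe star_isometry.uniformContinuous t).symm

theorem continuous_star' : Continuous (star : ProjectiveTensor A B → ProjectiveTensor A B) :=
  Completion.continuous_map (f := (star : AlgProjTensor A B → AlgProjTensor A B))

instance instContinuousStar : ContinuousStar (ProjectiveTensor A B) := ⟨continuous_star'⟩

instance instStarRing : StarRing (ProjectiveTensor A B) where
  star_involutive x := by
    refine denseRange_ofAlg.induction_on x (isClosed_eq (by fun_prop) (by fun_prop)) fun a => ?_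
    simp only [← ofAlg_star, star_star]
  star_mul x y := by
    refine denseRange_ofAlg.induction_on₂ ?_ (fun a b => ?_) x y
    · exact isClosed_eq (by fun_prop) (by fun_prop)
    · simp only [← ofAlg_mul, ← ofAlg_star, star_mul]
  star_add x y := by
    refine denseRange_ofAlg.induction_on₂ ?_ (fun a b => ?_) x y
    · exact isClosed_eq (by fun_prop) (by fun_prop)
    · simp only [← map_add, ← ofAlg_star, star_add]

instance instStarModule : StarModule ℂ (ProjectiveTensor A B) where
  star_smul c x := by
    refine denseRange_ofAlg.induction_on x (isClosed_eq
      (continuous_star.comp (continuous_const_smul c))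
      ((continuous_const_smul (star c)).comp continuous_star)) fun a => ?_
    simp only [← map_smul, ← ofAlg_star, star_smul]

instance instNormedStarGroup : NormedStarGroup (ProjectiveTensor A B) where
  norm_star_le x := by
    refine denseRange_ofAlg.induction_on x (isClosed_le (by fun_prop) (by fun_prop)) fun a => ?_
    simp only [← ofAlg_star, LinearIsometry.norm_map, norm_star, le_refl]

end Star

end ProjectiveTensor

/-- A Banach `*`-algebra `A` is rigidly symmetric if `A ⊗_γ B` is symmetric for every
C*-algebra `B`. -/
def IsRigidlySymmetric.{u, v} (A : Type u) [NonUnitalNormedRing A] [CompleteSpace A]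
    [StarRing A] [NormedStarGroup A] [NormedSpace ℂ A] [IsScalarTower ℂ A A]
    [SMulCommClass ℂ A A] [StarModule ℂ A] : Prop :=
  ∀ (B : Type v) [NonUnitalCStarAlgebra B], IsSymmetricStarAlgebra (ProjectiveTensor A B)

/-! ### The group algebra `ℓ¹(G)` of a discrete group -/

/-- The Banach space `ℓ¹(G)`, to be endowed with the convolution product. -/
def GroupL1 (G : Type*) : Type _ := lp (fun _ : G => ℂ) 1

namespace GroupL1

variable {G : Type*}

instance instNormedAddCommGroup : NormedAddCommGroup (GroupL1 G) :=
  inferInstanceAs (NormedAddCommGroup (lp (fun _ : G => ℂ) 1))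

instance instNormedSpace : NormedSpace ℂ (GroupL1 G) :=
  inferInstanceAs (NormedSpace ℂ (lp (fun _ : G => ℂ) 1))

instance instCompleteSpace : CompleteSpace (GroupL1 G) :=
  inferInstanceAs (CompleteSpace (lp (fun _ : G => ℂ) 1))

instance instFunLike : FunLike (GroupL1 G) G ℂ where
  coe f := f.1
  coe_injective := Subtype.coe_injective

theorem norm_eq_tsum (f : GroupL1 G) : ‖f‖ = ∑' s, ‖f s‖ := by
  have := lp.norm_eq_tsum_rpow (p := 1) (by simp) (show lp (fun _ : G => ℂ) 1 from f)
  simp only [ENNReal.toReal_one, Real.rpow_one, div_one] at this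
  exact this

theorem summable_norm (f : GroupL1 G) : Summable fun s => ‖f s‖ := by
  have := (lp.memℓp (show lp (fun _ : G => ℂ) 1 from f)).summable (by simp)
  simp only [ENNReal.toReal_one, Real.rpow_one] at this
  exact this

/-- A summable function as an element of `ℓ¹(G)`. -/
def mk (f : G → ℂ) (hf : Summable fun s => ‖f s‖) : GroupL1 G :=
  ⟨f, memℓp_gen (by simpa using hf)⟩

@[simp] theorem mk_apply (f : G → ℂ) (hf) (s : G) : mk f hf s = f s := rfl

@[ext] theorem ext {f g : GroupL1 G} (h : ∀ s, f s = g s) : f = g := DFunLike.ext _ _ h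

@[simp] theorem add_apply (f g : GroupL1 G) (s : G) : (f + g) s = f s + g s := rfl
@[simp] theorem zero_apply (s : G) : (0 : GroupL1 G) s = 0 := rfl
@[simp] theorem smul_apply (c : ℂ) (f : GroupL1 G) (s : G) : (c • f) s = c * f s := rfl

variable [Group G]

theorem summable_shear (f g : GroupL1 G) :
    Summable fun p : G × G => ‖f p.1‖ * ‖g (p.1⁻¹ * p.2)‖ := by
  have h := f.summable_norm.mul_of_nonneg g.summable_norm (fun _ => norm_nonneg _)
    (fun _ => norm_nonneg _)
  exact ((Equiv.prodShear (Equiv.refl G) (fun s => Equiv.mulLeft s⁻¹)).summable_iff).2 h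

theorem summable_conv_norm (f g : GroupL1 G) :
    Summable fun t => ‖∑' s, f s * g (s⁻¹ * t)‖ := by
  have h := (Equiv.prodComm G G).summable_iff.2 (summable_shear f g)
  refine Summable.of_nonneg_of_le (fun _ => norm_nonneg _) (fun t => ?_) h.prod
  have ht := h.prod_factor t
  simp only [Function.comp_def, Equiv.prodComm_apply, Prod.swap, ← norm_mul] at ht ⊢
  exact norm_tsum_le_tsum_norm ht

/-- The convolution product `(f * g)(t) = ∑ₛ f(s) g(s⁻¹ t)`. -/
instance instMul : Mul (GroupL1 G) where
  mul f g := mk (fun t => ∑' s, f s * g (s⁻¹ * t)) (summable_conv_norm f g)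

theorem mul_apply (f g : GroupL1 G) (t : G) : (f * g) t = ∑' s, f s * g (s⁻¹ * t) := rfl

/-- The involution `f*(t) = conj (f(t⁻¹))`. -/
instance instStar : Star (GroupL1 G) where
  star f := mk (fun t => star (f t⁻¹)) (by
    simpa [Function.comp_def] using (Equiv.inv G).summable_iff.2 f.summable_norm)

@[simp] theorem star_apply (f : GroupL1 G) (t : G) : star f t = star (f t⁻¹) := rfl

theorem summable_conv (f g : GroupL1 G) (t : G) : Summable fun s => f s * g (s⁻¹ * t) := by
  have h := ((Equiv.prodComm G G).summable_iff.2 (summable_shear f g)).prod_factor t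
  simp only [Function.comp_def, Equiv.prodComm_apply, Prod.swap, ← norm_mul] at h
  exact h.of_norm

theorem mul_assoc' (f g h : GroupL1 G) : f * g * h = f * (g * h) := by
  ext t
  simp only [mul_apply]
  have hF : Summable fun p : G × G => f p.1 * (g (p.1⁻¹ * p.2) * h (p.2⁻¹ * t)) := by
    have h1 := (summable_shear f g).mul_right ‖h‖
    refine Summable.of_norm_bounded h1 fun p => ?_
    rw [norm_mul, norm_mul, ← mul_assoc]
    gcongr
    exact lp.norm_apply_le_norm (p := 1) one_ne_zero (show lp (fun _ : G => ℂ) 1 from h) _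
  calc ∑' r, (∑' s, f s * g (s⁻¹ * r)) * h (r⁻¹ * t)
      = ∑' r, ∑' s, f s * (g (s⁻¹ * r) * h (r⁻¹ * t)) := by
        refine tsum_congr fun r => ?_
        rw [← tsum_mul_right]
        exact tsum_congr fun s => mul_assoc _ _ _
    _ = ∑' s, ∑' r, f s * (g (s⁻¹ * r) * h (r⁻¹ * t)) := (hF.tsum_comm)
    _ = ∑' s, f s * ∑' r, g r * h (r⁻¹ * (s⁻¹ * t)) := by
        refine tsum_congr fun s => ?_
        rw [tsum_mul_left, ← (Equiv.mulLeft s).tsum_eq]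
        simp [mul_assoc]

instance instNonUnitalNormedRing : NonUnitalNormedRing (GroupL1 G) :=
  { instNormedAddCommGroup (G := G), instMul (G := G) with
    zero_mul f := by ext t; simp [mul_apply]
    mul_zero f := by ext t; simp [mul_apply]
    left_distrib f g h := by
      ext t
      simp only [mul_apply, add_apply, mul_add]
      exact (summable_conv f g t).tsum_add (summable_conv f h t)
    right_distrib f g h := by
      ext t
      simp only [mul_apply, add_apply, add_mul]
      exact (summable_conv f h t).tsum_add (summable_conv g h t)
    mul_assoc := mul_assoc'
    norm_mul_le f g := by
      have hS := summable_shear f g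
      have hS' := (Equiv.prodComm G G).summable_iff.2 hS
      rw [norm_eq_tsum, norm_eq_tsum f, norm_eq_tsum g]
      calc ∑' t, ‖(f * g) t‖ ≤ ∑' t, ∑' s, ‖f s‖ * ‖g (s⁻¹ * t)‖ := by
            refine (summable_conv_norm f g).tsum_le_tsum (fun t => ?_) hS'.prod
            have ht := hS'.prod_factor t
            simp only [Function.comp_def, Equiv.prodComm_apply, Prod.swap, ← norm_mul] at ht ⊢
            exact norm_tsum_le_tsum_norm ht
        _ = ∑' s, ∑' t, ‖f s‖ * ‖g (s⁻¹ * t)‖ := hS.tsum_comm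
        _ = ∑' s, ‖f s‖ * ∑' t, ‖g t‖ := by
            refine tsum_congr fun s => ?_
            rw [tsum_mul_left]
            exact congrArg _ ((Equiv.mulLeft s⁻¹).tsum_eq fun t => ‖g t‖)
        _ = (∑' s, ‖f s‖) * ∑' t, ‖g t‖ := tsum_mul_right }

instance instIsScalarTower : IsScalarTower ℂ (GroupL1 G) (GroupL1 G) where
  smul_assoc c f g := by
    ext t
    simp only [smul_eq_mul, mul_apply, smul_apply, ← tsum_mul_left, mul_assoc]

instance instSMulCommClass : SMulCommClass ℂ (GroupL1 G) (GroupL1 G) where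
  smul_comm c f g := by
    ext t
    simp only [smul_eq_mul, mul_apply, smul_apply, ← tsum_mul_left]
    exact tsum_congr fun s => by ring

instance instStarRing : StarRing (GroupL1 G) where
  star_involutive f := by ext t; simp
  star_add f g := by ext t; simp
  star_mul f g := by
    ext t
    simp only [mul_apply, star_apply]
    rw [tsum_star]
    refine ((Equiv.mulLeft t⁻¹).tsum_eq _).symm.trans (tsum_congr fun u => ?_)
    simp [mul_comm]

instance instStarModule : StarModule ℂ (GroupL1 G) where
  star_smul c f := by ext t; simp

instance instNormedStarGroup : NormedStarGroup (GroupL1 G) where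
  norm_star_le f := by
    rw [norm_eq_tsum, norm_eq_tsum, ← (Equiv.inv G).tsum_eq]
    simp

end GroupL1

/-! ### The reduced group C*-algebra of a discrete group -/

section Reduced

variable (G : Type*) [Group G]

/-- The Hilbert space `ℓ²(G)`. -/
abbrev GroupL2 : Type _ := lp (fun _ : G => ℂ) 2

variable {G}

theorem memℓp_leftTranslate (s : G) (f : GroupL2 G) :
    Memℓp (fun t => f (s⁻¹ * t) : G → ℂ) 2 := by
  refine memℓp_gen ?_
  exact (Equiv.mulLeft s⁻¹).summable_iff.2 ((lp.memℓp f).summable (by simp))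

/-- Left translation `(λ(s) f)(t) = f(s⁻¹ t)` as a bounded operator on `ℓ²(G)`. -/
def leftRegular (s : G) : GroupL2 G →L[ℂ] GroupL2 G :=
  LinearMap.mkContinuous
    { toFun := fun f => ⟨fun t => f (s⁻¹ * t), memℓp_leftTranslate s f⟩
      map_add' := fun _ _ => rfl
      map_smul' := fun _ _ => rfl } 1 (fun f => by
        rw [one_mul, lp.norm_eq_tsum_rpow (by simp), lp.norm_eq_tsum_rpow (by simp)]
        exact le_of_eq (congrArg (· ^ _)
          ((Equiv.mulLeft s⁻¹).tsum_eq (fun t => ‖f t‖ ^ (2 : ℝ≥0∞).toReal))))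

theorem leftRegular_apply (s : G) (f : GroupL2 G) (t : G) :
    leftRegular s f t = f (s⁻¹ * t) := rfl

variable (G)

/-- The reduced group C*-algebra `C*_r(G)`: the norm closure in `B(ℓ²(G))` of the `*`-algebra
generated by the left translations `λ(s)`. -/
def reducedSubalgebra : StarSubalgebra ℂ (GroupL2 G →L[ℂ] GroupL2 G) :=
  (StarAlgebra.adjoin ℂ (Set.range leftRegular)).topologicalClosure

/-- `C*_r(G)` as a type. -/
def ReducedCStar : Type _ := reducedSubalgebra G

instance ReducedCStar.instCStarAlgebra : CStarAlgebra (ReducedCStar G) :=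
  StarSubalgebra.cstarAlgebra (reducedSubalgebra G)
    (h_closed := StarSubalgebra.isClosed_topologicalClosure _)

variable {G}

/-- The left translation `λ(s)` as an element of `C*_r(G)`. -/
def ReducedCStar.of (s : G) : ReducedCStar G :=
  ⟨leftRegular s, StarSubalgebra.le_topologicalClosure _
    (StarAlgebra.subset_adjoin ℂ _ ⟨s, rfl⟩)⟩

end Reduced

end

noncomputable section

/-! ### Bounded bilinear forms on projective tensor products -/

namespace ProjectiveTensor

section Space

variable {X Y : Type*} [NormedAddCommGroup X] [NormedSpace ℂ X]
  [NormedAddCommGroup Y] [NormedSpace ℂ Y]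

/-! The bridge between the projective tensor product and `ℓ¹(G)` is Cauchy–Schwarz. An operator `x`
in `C*_r(G)` has the square-summable Fourier coefficients `x δ_e`, of norm at most `‖x‖`. Hence
every function `ψ` on `G` with `|ψ| ≤ 1` gives a contractive bilinear form `(x, y) ↦ ∑ ψ(s) x̂(s)
ŷ(s)`, and so a contractive linear form `diagForm ψ` on `C*_r(G) ⊗_γ C*_r(G)` with value `ψ(s)` at
`λ(s) ⊗ λ(s)`. Thus the unit ball of `ℓ^∞(G)`, the dual of `ℓ¹(G)`, extends along the diagonal map
with no increase of norm. Taking for `ψ` the conjugate phase of `f` shows that the diagonal map does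
not decrease norms (`norm_diagonal`); that it does not increase them is clear.

The same forms disprove symmetry. Right multiplication by `λ(a) ⊗ λ(a)` replaces `ψ` by its right
translate (`diagForm_mul_of`), so a bounded eigenfunction of the adjacency operator of the Cayley
graph is an eigenform for right multiplication by the self-adjoint element `T = ∑ λ(a) ⊗ λ(a)`. The
Cayley graph of `F₂` is the 4-regular tree, and its exponential growth allows bounded eigenfunctions
with non-real eigenvalues: there is a radial one for `2i` (`sum_radialEigenfunction_mul`). An
eigenform that does not vanish at `T` puts the square `-4` of the eigenvalue into the spectrum of
`T* T` (`not_isSymmetricStarAlgebra_of_eigenform`). Pulled back along the diagonal map, the form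
does the same for `ℓ¹(F₂)`. As `C*_r(F₂)` is itself a C*-algebra, hence symmetric, it is also the
second factor that violates rigid symmetry. -/

theorem norm_tmul_le (x : X) (y : Y) : ‖tmul x y‖ ≤ ‖x‖ * ‖y‖ := by
  have h := AlgProjTensor.projNorm_ofList_le [(x, y)]
  simp only [AlgProjTensor.ofList, AlgProjTensor.cost, List.map_cons, List.map_nil,
    List.sum_cons, List.sum_nil, add_zero] at h
  rw [tmul, LinearIsometry.norm_map]
  exact h

/-- The linear form on the algebraic tensor product given by a bilinear form. -/
def algLift (u : X →ₗ[ℂ] Y →ₗ[ℂ] ℂ) : AlgProjTensor X Y →ₗ[ℂ] ℂ :=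
  (TensorProduct.lift u : X ⊗[ℂ] Y →ₗ[ℂ] ℂ)

theorem algLift_tmul (u : X →ₗ[ℂ] Y →ₗ[ℂ] ℂ) (x : X) (y : Y) :
    algLift u (AlgProjTensor.tmul x y) = u x y :=
  TensorProduct.lift.tmul (f' := u) x y

theorem norm_algLift_le (u : X →ₗ[ℂ] Y →ₗ[ℂ] ℂ) {C : ℝ} (hC : 0 ≤ C)
    (hu : ∀ x y, ‖u x y‖ ≤ C * (‖x‖ * ‖y‖)) (t : AlgProjTensor X Y) :
    ‖algLift u t‖ ≤ C * ‖t‖ := by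
  have key (l : List (X × Y)) :
      ‖algLift u (AlgProjTensor.ofList l)‖ ≤ C * AlgProjTensor.cost l := by
    induction l with
    | nil => simp [AlgProjTensor.ofList, AlgProjTensor.cost]
    | cons p l ih =>
      simp only [AlgProjTensor.ofList, AlgProjTensor.cost, List.map_cons, List.sum_cons, map_add,
        mul_add, algLift_tmul] at ih ⊢
      exact (norm_add_le _ _).trans (add_le_add (hu _ _) ih)
  refine le_of_forall_pos_le_add fun ε hε => ?_
  -- Dividing by `C + 1` instead of `C` covers the case `C = 0`.
  obtain ⟨l, hl, h⟩ := AlgProjTensor.exists_cost_lt t (ε := ε / (C + 1)) (by positivity)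
  have h1 : C * (ε / (C + 1)) ≤ ε := by
    rw [← mul_div_assoc, div_le_iff₀ (by positivity)]
    nlinarith
  rw [← AlgProjTensor.norm_def] at h
  have h2 := key l
  rw [← hl] at h2
  nlinarith [mul_le_mul_of_nonneg_left h.le hC]

/-- A bounded bilinear form on `X × Y` as a bounded linear form on `X ⊗_γ Y`. -/
def lift (u : X →ₗ[ℂ] Y →ₗ[ℂ] ℂ) (C : ℝ) (hC : 0 ≤ C)
    (hu : ∀ x y, ‖u x y‖ ≤ C * (‖x‖ * ‖y‖)) : ProjectiveTensor X Y →L[ℂ] ℂ :=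
  ((algLift u).mkContinuous C (norm_algLift_le u hC hu)).extend ofAlg.toContinuousLinearMap

theorem lift_ofAlg (u : X →ₗ[ℂ] Y →ₗ[ℂ] ℂ) (C : ℝ) (hC : 0 ≤ C)
    (hu : ∀ x y, ‖u x y‖ ≤ C * (‖x‖ * ‖y‖)) (t : AlgProjTensor X Y) :
    lift u C hC hu (ofAlg t) = algLift u t :=
  ContinuousLinearMap.extend_eq (e := ofAlg.toContinuousLinearMap)
    ((algLift u).mkContinuous C (norm_algLift_le u hC hu)) denseRange_ofAlg
    ofAlg.isometry.isUniformInducing t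

theorem lift_tmul (u : X →ₗ[ℂ] Y →ₗ[ℂ] ℂ) (C : ℝ) (hC : 0 ≤ C)
    (hu : ∀ x y, ‖u x y‖ ≤ C * (‖x‖ * ‖y‖)) (x : X) (y : Y) :
    lift u C hC hu (tmul x y) = u x y := by
  rw [tmul, lift_ofAlg, algLift_tmul]

theorem norm_lift_apply_le (u : X →ₗ[ℂ] Y →ₗ[ℂ] ℂ) (C : ℝ) (hC : 0 ≤ C)
    (hu : ∀ x y, ‖u x y‖ ≤ C * (‖x‖ * ‖y‖)) (t : ProjectiveTensor X Y) :
    ‖lift u C hC hu t‖ ≤ C * ‖t‖ := by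
  refine denseRange_ofAlg.induction_on t (isClosed_le (by fun_prop) (by fun_prop)) fun s => ?_
  rw [lift_ofAlg, LinearIsometry.norm_map]
  exact norm_algLift_le u hC hu s

@[elab_as_elim]
theorem induction_tmul {p : ProjectiveTensor X Y → Prop} (t : ProjectiveTensor X Y)
    (closed : IsClosed {t | p t}) (zero : p 0) (tmul : ∀ x y, p (tmul x y))
    (add : ∀ s t, p s → p t → p (s + t)) : p t := by
  refine denseRange_ofAlg.induction_on t closed fun s => ?_
  induction s using AlgProjTensor.induction with
  | zero => rwa [map_zero]
  | tmul x y => exact tmul x y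
  | add s t hs ht =>
    rw [map_add]
    exact add _ _ hs ht

end Space

theorem tmul_mul_tmul {A B : Type*}
    [NonUnitalNormedRing A] [NormedSpace ℂ A] [IsScalarTower ℂ A A] [SMulCommClass ℂ A A]
    [NonUnitalNormedRing B] [NormedSpace ℂ B] [IsScalarTower ℂ B B] [SMulCommClass ℂ B B]
    (a a' : A) (b b' : B) :
    (tmul a b * tmul a' b' : ProjectiveTensor A B) = tmul (a * a') (b * b') := by
  rw [tmul, tmul, ← ofAlg_mul, AlgProjTensor.tmul_mul_tmul, tmul]

theorem star_tmul {A B : Type*}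
    [NonUnitalNormedRing A] [StarRing A] [NormedStarGroup A]
    [NormedSpace ℂ A] [IsScalarTower ℂ A A] [SMulCommClass ℂ A A] [StarModule ℂ A]
    [NonUnitalNormedRing B] [StarRing B] [NormedStarGroup B]
    [NormedSpace ℂ B] [IsScalarTower ℂ B B] [SMulCommClass ℂ B B] [StarModule ℂ B]
    (a : A) (b : B) :
    star (tmul a b : ProjectiveTensor A B) = tmul (star a) (star b) := by
  rw [tmul, ← ofAlg_star, AlgProjTensor.star_tmul, tmul]

end ProjectiveTensor

/-! ### Homomorphisms out of `ℓ¹(G)` -/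

namespace GroupL1

variable {G : Type*} [Group G] {A : Type*} [NonUnitalNormedRing A] [CompleteSpace A]
  [NormedSpace ℂ A]

theorem summable_norm_smul (u : G → A) (hu : ∀ s, ‖u s‖ ≤ 1) (f : GroupL1 G) :
    Summable fun s => ‖f s • u s‖ := by
  refine f.summable_norm.of_nonneg_of_le (fun _ => norm_nonneg _) fun s => ?_
  rw [norm_smul]
  exact mul_le_of_le_one_right (norm_nonneg _) (hu s)

variable [IsScalarTower ℂ A A] [SMulCommClass ℂ A A]

/-- The product of the two sums is an absolutely convergent double sum. The shear `(s, t) ↦ (s, s⁻¹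
t)` makes the group element in each term equal to `t`, and summing over `s` first produces the
convolution. -/
theorem tsum_smul_mul_tsum_smul (u : G → A) (hu : ∀ s, ‖u s‖ ≤ 1)
    (hmul : ∀ s t, u (s * t) = u s * u t) (f g : GroupL1 G) :
    ∑' t, (f * g) t • u t = (∑' s, f s • u s) * ∑' t, g t • u t := by
  have hf := summable_norm_smul u hu f
  have hg := summable_norm_smul u hu g
  have hfg : Summable fun p : G × G => (f p.1 • u p.1) * (g p.2 • u p.2) :=
    Summable.of_norm_bounded
      (hf.mul_of_nonneg hg (fun _ => norm_nonneg _) (fun _ => norm_nonneg _))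
      fun _ => norm_mul_le _ _
  let e : G × G ≃ G × G := Equiv.prodShear (Equiv.refl G) fun s => Equiv.mulLeft s⁻¹
  let F : G × G → A := fun p => (f p.1 * g (p.1⁻¹ * p.2)) • u p.2
  have hF : (fun p : G × G => (f p.1 • u p.1) * (g p.2 • u p.2)) ∘ e = F := by
    funext p
    change (f p.1 • u p.1) * (g (p.1⁻¹ * p.2) • u (p.1⁻¹ * p.2)) = _
    rw [smul_mul_smul_comm, ← hmul, mul_inv_cancel_left]
  have hS : Summable F := hF ▸ e.summable_iff.2 hfg
  have h1 : (∑' s, f s • u s) * ∑' t, g t • u t = ∑' p, F p := by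
    rw [hf.of_norm.tsum_mul_tsum hg.of_norm hfg, ← e.tsum_eq, ← hF]
    rfl
  have h2 : ∑' t, (f * g) t • u t = ∑' t, ∑' s, F (s, t) :=
    tsum_congr fun t => by rw [mul_apply, ← (summable_conv f g t).tsum_smul_const]
  rw [h1, h2, hS.tsum_prod]
  exact Summable.tsum_comm (f := fun s t => F (s, t)) hS

variable [StarRing A] [NormedStarGroup A] [StarModule ℂ A]

/-- The `*`-homomorphism `f ↦ ∑ f(s) u(s)` given by a contractive `*`-representation `u` of `G`. -/
def liftHom (u : G → A) (hu : ∀ s, ‖u s‖ ≤ 1) (hmul : ∀ s t, u (s * t) = u s * u t)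
    (hstar : ∀ s, star (u s) = u s⁻¹) : GroupL1 G →⋆ₙₐ[ℂ] A where
  toFun f := ∑' s, f s • u s
  map_smul' c f := by
    simp only [smul_apply, mul_smul]
    exact (summable_norm_smul u hu f).of_norm.tsum_const_smul c
  map_zero' := by simp
  map_add' f g := by
    simp only [add_apply, add_smul]
    exact (summable_norm_smul u hu f).of_norm.tsum_add (summable_norm_smul u hu g).of_norm
  map_mul' := tsum_smul_mul_tsum_smul u hu hmul
  map_star' f := by
    rw [tsum_star, ← (Equiv.inv G).tsum_eq]
    simp [star_smul, hstar]

theorem hasSum_liftHom (u : G → A) (hu : ∀ s, ‖u s‖ ≤ 1) (hmul : ∀ s t, u (s * t) = u s * u t)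
    (hstar : ∀ s, star (u s) = u s⁻¹) (f : GroupL1 G) :
    HasSum (fun s => f s • u s) (liftHom u hu hmul hstar f) :=
  (summable_norm_smul u hu f).of_norm.hasSum

theorem norm_liftHom_le (u : G → A) (hu : ∀ s, ‖u s‖ ≤ 1) (hmul : ∀ s t, u (s * t) = u s * u t)
    (hstar : ∀ s, star (u s) = u s⁻¹) (f : GroupL1 G) : ‖liftHom u hu hmul hstar f‖ ≤ ‖f‖ := by
  rw [norm_eq_tsum]
  refine (hasSum_liftHom u hu hmul hstar f).norm_le_of_bounded f.summable_norm.hasSum fun s => ?_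
  rw [norm_smul]
  exact mul_le_of_le_one_right (norm_nonneg _) (hu s)

/-- The function in `ℓ¹(G)` that is `1` at `s` and `0` elsewhere. -/
def delta [DecidableEq G] (s : G) : GroupL1 G :=
  mk (Pi.single s 1) (summable_of_ne_finset_zero (s := {s}) fun t ht => by
    simp [Pi.single_eq_of_ne (show t ≠ s by simpa using ht)])

theorem delta_apply [DecidableEq G] (s t : G) : delta s t = (Pi.single s 1 : G → ℂ) t := rfl

theorem star_delta [DecidableEq G] (s : G) : star (delta s) = delta s⁻¹ := by
  ext t
  by_cases h : t = s⁻¹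
  · subst h; simp [delta_apply]
  · have h' : t⁻¹ ≠ s := fun h' => h (by rw [← h', inv_inv])
    simp [delta_apply, h, h']

theorem liftHom_delta [DecidableEq G] (u : G → A) (hu : ∀ s, ‖u s‖ ≤ 1)
    (hmul : ∀ s t, u (s * t) = u s * u t) (hstar : ∀ s, star (u s) = u s⁻¹) (s : G) :
    liftHom u hu hmul hstar (delta s) = u s := by
  refine (hasSum_liftHom u hu hmul hstar _).unique ?_
  have h := hasSum_single (f := fun t => delta s t • u t) s fun t ht => by simp [delta_apply, ht]
  simpa [delta_apply] using h

end GroupL1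

/-! ### Fourier coefficients on the reduced group C*-algebra -/

section Reduced

variable {G : Type*} [Group G]

theorem star_leftRegular (s : G) : star (leftRegular s) = leftRegular s⁻¹ := by
  rw [ContinuousLinearMap.star_eq_adjoint, eq_comm, ContinuousLinearMap.eq_adjoint_iff]
  intro x y
  rw [lp.inner_eq_tsum, lp.inner_eq_tsum, ← (Equiv.mulLeft s⁻¹).tsum_eq]
  simp [leftRegular_apply]

theorem leftRegular_mul (s t : G) : leftRegular (s * t) = leftRegular s * leftRegular t := by
  ext f r
  simp [leftRegular_apply, mul_assoc]

theorem norm_leftRegular_le (s : G) : ‖leftRegular s‖ ≤ 1 :=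
  LinearMap.mkContinuous_norm_le _ zero_le_one _

theorem memℓp_rightTranslate (a : G) (f : GroupL2 G) :
    Memℓp (fun t => f (t * a) : G → ℂ) 2 := by
  refine memℓp_gen ?_
  exact (Equiv.mulRight a).summable_iff.2 ((lp.memℓp f).summable (by simp))

/-- Right translation `(ρ(a) f)(t) = f(t a)` as a bounded operator on `ℓ²(G)`. -/
def rightRegular (a : G) : GroupL2 G →L[ℂ] GroupL2 G :=
  LinearMap.mkContinuous
    { toFun := fun f => ⟨fun t => f (t * a), memℓp_rightTranslate a f⟩
      map_add' := fun _ _ => rfl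
      map_smul' := fun _ _ => rfl } 1 (fun f => by
        rw [one_mul, lp.norm_eq_tsum_rpow (by simp), lp.norm_eq_tsum_rpow (by simp)]
        exact le_of_eq (congrArg (· ^ _)
          ((Equiv.mulRight a).tsum_eq (fun t => ‖f t‖ ^ (2 : ℝ≥0∞).toReal))))

theorem rightRegular_apply (a : G) (f : GroupL2 G) (t : G) :
    rightRegular a f t = f (t * a) := rfl

theorem rightRegular_mul_leftRegular (a s : G) :
    rightRegular a * leftRegular s = leftRegular s * rightRegular a := by
  ext f t
  simp [leftRegular_apply, rightRegular_apply, mul_assoc]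

/-- Left and right translations commute, and a centralizer is a closed `*`-subalgebra, so it is
enough to look at the generators `λ(s)`. -/
theorem reducedSubalgebra_le_centralizer (a : G) :
    reducedSubalgebra G ≤ StarSubalgebra.centralizer ℂ {rightRegular a} := by
  refine StarSubalgebra.topologicalClosure_minimal (StarAlgebra.adjoin_le_iff.2 ?_)
    (Set.isClosed_centralizer _)
  rintro _ ⟨s, rfl⟩
  rw [SetLike.mem_coe, StarSubalgebra.mem_centralizer_iff]
  rintro _ rfl
  -- Membership also requires commuting with the adjoint of `ρ(a)`; taking adjoints reduces this to
  -- the commutation of `ρ(a)` with `λ(s⁻¹)`, without computing the adjoint of `ρ(a)`.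
  refine ⟨rightRegular_mul_leftRegular a s, star_injective ?_⟩
  rw [star_mul, star_mul, star_star, star_leftRegular, rightRegular_mul_leftRegular]

namespace ReducedCStar

/-- The inclusion of `C*_r(G)` into `B(ℓ²(G))`. -/
def toCLM : ReducedCStar G →⋆ₐ[ℂ] (GroupL2 G →L[ℂ] GroupL2 G) := (reducedSubalgebra G).subtype

theorem toCLM_injective : Function.Injective (toCLM (G := G)) := Subtype.val_injective

theorem norm_toCLM (x : ReducedCStar G) : ‖toCLM x‖ = ‖x‖ := rfl

theorem toCLM_of (s : G) : toCLM (of s) = leftRegular s := rfl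

theorem of_mul (s t : G) : of (s * t) = of s * of t :=
  toCLM_injective (by rw [map_mul, toCLM_of, toCLM_of, toCLM_of, leftRegular_mul])

theorem star_of (s : G) : star (of s) = of s⁻¹ :=
  toCLM_injective (by rw [map_star, toCLM_of, toCLM_of, star_leftRegular])

theorem norm_of_le (s : G) : ‖of s‖ ≤ 1 := norm_leftRegular_le s

theorem toCLM_rightRegular (x : ReducedCStar G) (a : G) (f : GroupL2 G) :
    toCLM x (rightRegular a f) = rightRegular a (toCLM x f) :=
  (DFunLike.congr_fun (((StarSubalgebra.mem_centralizer_iff ℂ).1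
    (reducedSubalgebra_le_centralizer a x.2) _ rfl).1) f).symm

variable [DecidableEq G]

/-- The Fourier coefficients `s ↦ ⟨δ_s, x δ_e⟩` of `x`. -/
def coeff : ReducedCStar G →ₗ[ℂ] GroupL2 G where
  toFun x := toCLM x (lp.single 2 1 1)
  map_add' x y := by rw [map_add, add_apply]
  map_smul' c x := by rw [map_smul, smul_apply]; rfl

theorem norm_coeff_le (x : ReducedCStar G) : ‖coeff x‖ ≤ ‖x‖ := by
  refine ((toCLM x).le_opNorm _).trans_eq ?_
  rw [lp.norm_single (by simp), norm_one, mul_one, norm_toCLM]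

/-- As `λ(a) δ_e = ρ(a⁻¹) δ_e` and `x` commutes with right translations, `x λ(a) δ_e = ρ(a⁻¹) x
δ_e`. -/
theorem coeff_mul_of (x : ReducedCStar G) (a t : G) : coeff (x * of a) t = coeff x (t * a⁻¹) := by
  have h : leftRegular a (lp.single 2 1 1) = rightRegular a⁻¹ (lp.single 2 1 1 : GroupL2 G) := by
    ext t
    rw [leftRegular_apply, rightRegular_apply, lp.single_apply, lp.single_apply, Pi.single_apply,
      Pi.single_apply]
    exact if_congr (by rw [inv_mul_eq_one, mul_inv_eq_one, eq_comm]) rfl rfl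
  change toCLM (x * of a) (lp.single 2 1 1) t = rightRegular a⁻¹ (toCLM x (lp.single 2 1 1)) t
  rw [map_mul, mul_apply_eq_comp, toCLM_of, h, toCLM_rightRegular]

theorem coeff_of (s t : G) : coeff (of s) t = (Pi.single s 1 : G → ℂ) t := by
  change leftRegular s (lp.single 2 1 1) t = _
  rw [leftRegular_apply, lp.single_apply, Pi.single_apply, Pi.single_apply]
  exact if_congr (by rw [inv_mul_eq_one, eq_comm]) rfl rfl

end ReducedCStar

/-! ### Diagonal bilinear forms given by bounded functions on the group -/

theorem GroupL2.summable_norm_mul (f g : GroupL2 G) : Summable fun s => ‖f s‖ * ‖g s‖ := by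
  have hf := (lp.memℓp f).summable (by simp)
  have hg := (lp.memℓp g).summable (by simp)
  simp only [ENNReal.toReal_ofNat] at hf hg
  exact Real.summable_mul_of_Lp_Lq_of_nonneg Real.HolderConjugate.two_two
    (fun _ => norm_nonneg _) (fun _ => norm_nonneg _) hf hg

theorem GroupL2.tsum_norm_mul_le (f g : GroupL2 G) : ∑' s, ‖f s‖ * ‖g s‖ ≤ ‖f‖ * ‖g‖ := by
  have hf := (lp.memℓp f).summable (by simp)
  have hg := (lp.memℓp g).summable (by simp)
  rw [lp.norm_eq_tsum_rpow (by simp), lp.norm_eq_tsum_rpow (by simp)]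
  simp only [ENNReal.toReal_ofNat] at hf hg ⊢
  exact Real.inner_le_Lp_mul_Lq_tsum_of_nonneg Real.HolderConjugate.two_two
    (fun _ => norm_nonneg _) (fun _ => norm_nonneg _) hf hg

namespace ReducedCStar

variable [DecidableEq G]

theorem summable_diag {ψ : G → ℂ} (hψ : ∀ s, ‖ψ s‖ ≤ 1) (x y : ReducedCStar G) :
    Summable fun s => ψ s * (coeff x s * coeff y s) := by
  refine Summable.of_norm_bounded (GroupL2.summable_norm_mul (coeff x) (coeff y)) fun s => ?_
  rw [norm_mul, norm_mul]
  exact mul_le_of_le_one_left (by positivity) (hψ s)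

/-- The bilinear form `(x, y) ↦ ∑ ψ(s) x̂(s) ŷ(s)` on `C*_r(G)`. -/
def diagBilin (ψ : G → ℂ) (hψ : ∀ s, ‖ψ s‖ ≤ 1) :
    ReducedCStar G →ₗ[ℂ] ReducedCStar G →ₗ[ℂ] ℂ :=
  LinearMap.mk₂ ℂ (fun x y => ∑' s, ψ s * (coeff x s * coeff y s))
    (fun x x' y => by
      rw [← (summable_diag hψ x y).tsum_add (summable_diag hψ x' y)]
      refine tsum_congr fun s => ?_
      rw [map_add, lp.coeFn_add, Pi.add_apply]; ring)
    (fun c x y => by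
      rw [smul_eq_mul, ← tsum_mul_left]
      refine tsum_congr fun s => ?_
      rw [map_smul, lp.coeFn_smul, Pi.smul_apply, smul_eq_mul]; ring)
    (fun x y y' => by
      rw [← (summable_diag hψ x y).tsum_add (summable_diag hψ x y')]
      refine tsum_congr fun s => ?_
      rw [map_add, lp.coeFn_add, Pi.add_apply]; ring)
    (fun c x y => by
      rw [smul_eq_mul, ← tsum_mul_left]
      refine tsum_congr fun s => ?_
      rw [map_smul, lp.coeFn_smul, Pi.smul_apply, smul_eq_mul]; ring)

theorem diagBilin_apply (ψ : G → ℂ) (hψ : ∀ s, ‖ψ s‖ ≤ 1) (x y : ReducedCStar G) :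
    diagBilin ψ hψ x y = ∑' s, ψ s * (coeff x s * coeff y s) := rfl

theorem norm_diagBilin_le (ψ : G → ℂ) (hψ : ∀ s, ‖ψ s‖ ≤ 1) (x y : ReducedCStar G) :
    ‖diagBilin ψ hψ x y‖ ≤ 1 * (‖x‖ * ‖y‖) := by
  rw [one_mul, diagBilin_apply]
  have hs := GroupL2.summable_norm_mul (coeff x) (coeff y)
  refine (tsum_of_norm_bounded hs.hasSum fun s => ?_).trans
    ((GroupL2.tsum_norm_mul_le _ _).trans ?_)
  · rw [norm_mul, norm_mul]
    exact mul_le_of_le_one_left (by positivity) (hψ s)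
  · gcongr <;> exact norm_coeff_le _

/-- The contractive linear form on `C*_r(G) ⊗_γ C*_r(G)` given by `diagBilin`. -/
def diagForm (ψ : G → ℂ) (hψ : ∀ s, ‖ψ s‖ ≤ 1) :
    ProjectiveTensor (ReducedCStar G) (ReducedCStar G) →L[ℂ] ℂ :=
  ProjectiveTensor.lift (diagBilin ψ hψ) 1 zero_le_one (norm_diagBilin_le ψ hψ)

theorem diagForm_tmul (ψ : G → ℂ) (hψ : ∀ s, ‖ψ s‖ ≤ 1) (x y : ReducedCStar G) :
    diagForm ψ hψ (ProjectiveTensor.tmul x y) = ∑' s, ψ s * (coeff x s * coeff y s) :=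
  ProjectiveTensor.lift_tmul (diagBilin ψ hψ) 1 zero_le_one (norm_diagBilin_le ψ hψ) x y

theorem norm_diagForm_apply_le (ψ : G → ℂ) (hψ : ∀ s, ‖ψ s‖ ≤ 1)
    (t : ProjectiveTensor (ReducedCStar G) (ReducedCStar G)) : ‖diagForm ψ hψ t‖ ≤ ‖t‖ :=
  (ProjectiveTensor.norm_lift_apply_le (diagBilin ψ hψ) 1 zero_le_one
    (norm_diagBilin_le ψ hψ) t).trans_eq (one_mul _)

theorem diagForm_of (ψ : G → ℂ) (hψ : ∀ s, ‖ψ s‖ ≤ 1) (s : G) :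
    diagForm ψ hψ (ProjectiveTensor.tmul (of s) (of s)) = ψ s := by
  rw [diagForm_tmul, tsum_eq_single s fun t ht => by simp [coeff_of, ht]]
  simp [coeff_of]

/-- Both factors have their coefficients translated by the same `a`, so the substitution `s ↦ s a`
moves the translation onto `ψ`. -/
theorem diagForm_mul_of (ψ : G → ℂ) (hψ : ∀ s, ‖ψ s‖ ≤ 1) (a : G)
    (t : ProjectiveTensor (ReducedCStar G) (ReducedCStar G)) :
    diagForm ψ hψ (t * ProjectiveTensor.tmul (of a) (of a)) =
      diagForm (fun s => ψ (s * a)) (fun s => hψ (s * a)) t := by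
  induction t using ProjectiveTensor.induction_tmul with
  | closed => exact isClosed_eq (by fun_prop) (by fun_prop)
  | zero => simp
  | add s t hs ht => rw [add_mul, map_add, map_add, hs, ht]
  | tmul x y =>
    rw [ProjectiveTensor.tmul_mul_tmul, diagForm_tmul, diagForm_tmul,
      ← (Equiv.mulRight a).tsum_eq]
    simp [coeff_mul_of]

/-- If `∑ₐ ψ(s a) = z ψ(s)` for all `s`, then `diagForm ψ` is an eigenvector of the right
multiplication with `∑ₐ λ(a) ⊗ λ(a)`. -/
theorem diagForm_mul_sum {ι : Type*} [Fintype ι] (ψ : G → ℂ) (hψ : ∀ s, ‖ψ s‖ ≤ 1) (a : ι → G)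
    (z : ℂ) (hz : ∀ s, ∑ i, ψ (s * a i) = z * ψ s)
    (t : ProjectiveTensor (ReducedCStar G) (ReducedCStar G)) :
    diagForm ψ hψ (t * ∑ i, ProjectiveTensor.tmul (of (a i)) (of (a i))) =
      z * diagForm ψ hψ t := by
  rw [Finset.mul_sum, map_sum]
  simp only [diagForm_mul_of]
  induction t using ProjectiveTensor.induction_tmul with
  | closed =>
    exact isClosed_eq (continuous_finsetSum _ fun i _ => by fun_prop) (by fun_prop)
  | zero => simp
  | add s t hs ht => simp only [map_add, Finset.sum_add_distrib, mul_add, hs, ht]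
  | tmul x y =>
    simp only [diagForm_tmul]
    rw [← Summable.tsum_finsetSum fun i _ => summable_diag (fun s => hψ (s * a i)) x y,
      ← tsum_mul_left]
    refine tsum_congr fun s => ?_
    rw [← Finset.sum_mul, hz, mul_assoc]

/-! ### The diagonal embedding of `ℓ¹(G)` -/

theorem tmul_of_mul (s t : G) :
    (ProjectiveTensor.tmul (of (s * t)) (of (s * t)) :
      ProjectiveTensor (ReducedCStar G) (ReducedCStar G)) =
      ProjectiveTensor.tmul (of s) (of s) * ProjectiveTensor.tmul (of t) (of t) := by
  rw [ProjectiveTensor.tmul_mul_tmul, of_mul]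

theorem star_tmul_of (s : G) :
    star (ProjectiveTensor.tmul (of s) (of s) :
      ProjectiveTensor (ReducedCStar G) (ReducedCStar G)) =
      ProjectiveTensor.tmul (of s⁻¹) (of s⁻¹) := by
  rw [ProjectiveTensor.star_tmul, star_of]

theorem norm_tmul_of_le (s : G) :
    ‖(ProjectiveTensor.tmul (of s) (of s) :
      ProjectiveTensor (ReducedCStar G) (ReducedCStar G))‖ ≤ 1 :=
  (ProjectiveTensor.norm_tmul_le _ _).trans
    (mul_le_one₀ (norm_of_le s) (norm_nonneg _) (norm_of_le s))

variable (G) in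
/-- The diagonal embedding `f ↦ ∑ f(s) λ(s) ⊗ λ(s)`. -/
def diagonal : GroupL1 G →⋆ₙₐ[ℂ] ProjectiveTensor (ReducedCStar G) (ReducedCStar G) :=
  GroupL1.liftHom (fun s => ProjectiveTensor.tmul (of s) (of s)) norm_tmul_of_le tmul_of_mul
    star_tmul_of

theorem hasSum_diagonal (f : GroupL1 G) :
    HasSum (fun s => f s • ProjectiveTensor.tmul (of s) (of s)) (diagonal G f) :=
  GroupL1.hasSum_liftHom _ norm_tmul_of_le tmul_of_mul star_tmul_of f

theorem norm_diagonal (f : GroupL1 G) : ‖diagonal G f‖ = ‖f‖ := by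
  refine le_antisymm (GroupL1.norm_liftHom_le _ norm_tmul_of_le tmul_of_mul star_tmul_of f) ?_
  -- The conjugate phase of `f`. Division by zero gives the value `0` where `f` vanishes, so that `f
  -- ψ = |f|` holds everywhere and `diagForm ψ` takes the value `‖f‖` at the image of `f`.
  let ψ : G → ℂ := fun s => star (f s) / ‖f s‖
  have hψ (s : G) : ‖ψ s‖ ≤ 1 := by
    simp only [ψ, norm_div, norm_star, Complex.norm_real, norm_norm]
    exact div_self_le_one _
  have hψf (s : G) : f s * ψ s = (‖f s‖ : ℂ) := by
    by_cases h : f s = 0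
    · simp [h]
    · have : (‖f s‖ : ℂ) ≠ 0 := by simpa using h
      rw [← mul_div_assoc, div_eq_iff this, Complex.star_def, Complex.mul_conj']
      ring
  have h1 := (hasSum_diagonal f).mapL (diagForm ψ hψ)
  simp only [map_smul, diagForm_of, smul_eq_mul, hψf] at h1
  have h2 : diagForm ψ hψ (diagonal G f) = ((‖f‖ : ℝ) : ℂ) := by
    rw [GroupL1.norm_eq_tsum]
    exact h1.unique (Complex.hasSum_ofReal.2 f.summable_norm.hasSum)
  calc ‖f‖ = ‖diagForm ψ hψ (diagonal G f)‖ := by rw [h2]; simp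
    _ ≤ _ := norm_diagForm_apply_le ψ hψ _

theorem isometry_diagonal : Isometry (diagonal G) :=
  AddMonoidHomClass.isometry_of_norm _ norm_diagonal

end ReducedCStar

end Reduced

/-! ### Symmetry -/

theorem CStarAlgebra.isSymmetricStarAlgebra (A : Type*) [CStarAlgebra A] :
    IsSymmetricStarAlgebra A := by
  rw [isSymmetricStarAlgebra_iff_spectrum]
  intro a z hz
  have h := (IsSelfAdjoint.star_mul_self a).spectrumRestricts
  obtain ⟨r, hr, rfl⟩ := h.algebraMap_image.symm.subset hz
  exact ⟨r, spectrum_star_mul_self_nonneg r hr, rfl⟩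

/-- If right multiplication with a self-adjoint `f` has a left eigenvector with an eigenvalue `z`
such that `z²` is not a nonnegative real, then the algebra is not symmetric. -/
theorem not_isSymmetricStarAlgebra_of_eigenform {A : Type*} [NonUnitalRing A] [Star A] [Module ℂ A]
    [IsScalarTower ℂ A A] [SMulCommClass ℂ A A]
    (f : A) (hf : star f = f) (Φ : A →ₗ[ℂ] ℂ) (z : ℂ) (hΦ : ∀ g, Φ (g * f) = z * Φ g)
    (h0 : Φ f ≠ 0) (hz : ∀ r : ℝ, 0 ≤ r → z ^ 2 ≠ r) : ¬ IsSymmetricStarAlgebra A := by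
  intro h
  have hz0 : z ^ 2 ≠ 0 := by simpa using hz 0 le_rfl
  have hmem : z ^ 2 ∈ quasispectrum ℂ (star f * f) := by
    intro hu hq
    -- Put `x = -z⁻² f f`. Of the two equations for a quasi-inverse `y`, the one containing `y x` is
    -- kept, as `hΦ` concerns right multiplication. It gives `Φ (y x) = -Φ y`, so the terms in `y`
    -- cancel and `Φ x = -z⁻¹ Φ f` must vanish.
    obtain ⟨y, -, hy⟩ := isQuasiregular_iff.1 hq
    have hu' : ((hu.unit⁻¹ : ℂˣ) : ℂ) = (z ^ 2)⁻¹ := by simp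
    rw [hf, Units.smul_def, hu'] at hy
    have h1 := congrArg Φ hy
    rw [map_add, map_add, map_zero, mul_neg, mul_smul_comm, ← mul_assoc, map_neg, map_neg, map_smul,
      map_smul, hΦ, hΦ, hΦ, smul_eq_mul, smul_eq_mul] at h1
    have hz1 : z ≠ 0 := by rintro rfl; simp at hz0
    field_simp at h1
    apply h0
    linear_combination -h1
  obtain ⟨r, hr, hr'⟩ := h f hmem
  exact hz r hr hr'.symm

/-! ### A radial eigenfunction on the free group -/

namespace FreeGroup

variable {α : Type*} [DecidableEq α]

theorem norm_mk_singleton_mul (p : α × Bool) (w : FreeGroup α) :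
    (mk [p] * w).norm =
      if w.toWord.head? = some (p.1, !p.2) then w.norm - 1 else w.norm + 1 := by
  have h : (mk [p] * w).toWord = reduce (p :: w.toWord) := by
    conv_lhs => rw [← mk_toWord (x := w), mul_mk, toWord_mk]
    rfl
  rw [norm, h, reduce.cons, reduce_toWord, norm]
  rcases w.toWord with _ | ⟨q, l⟩
  · simp
  · have : (p.1 = q.1 ∧ p.2 = !q.2) ↔ q = (p.1, !p.2) := by
      obtain ⟨a, b⟩ := p; obtain ⟨c, d⟩ := q
      cases b <;> cases d <;> simp [eq_comm]
    simp only [List.head?_cons, Option.some.injEq, this, List.length_cons]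
    split_ifs <;> simp

/-- In the Cayley tree, a vertex other than the root has exactly one neighbour nearer to the root,
obtained by cancelling the first letter; all other neighbours are farther away. Since `w ≠ 1`,
neither natural-number subtraction is truncated. -/
theorem sum_radial_mk_singleton_mul [Fintype α] {M : Type*} [AddCommGroup M] (φ : ℕ → M)
    (w : FreeGroup α) (hw : w ≠ 1) :
    ∑ p : α × Bool, φ (mk [p] * w).norm =
      φ (w.norm - 1) + (2 * Fintype.card α - 1) • φ (w.norm + 1) := by
  have hw' : w.toWord ≠ [] := mt toWord_eq_nil_iff.1 hw
  obtain ⟨q, l, hq⟩ := List.exists_cons_of_ne_nil hw'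
  have key (p : α × Bool) : φ (mk [p] * w).norm =
      if p = (q.1, !q.2) then φ (w.norm - 1) else φ (w.norm + 1) := by
    rw [norm_mk_singleton_mul, apply_ite φ]
    refine if_congr ?_ rfl rfl
    obtain ⟨a, b⟩ := p; obtain ⟨c, d⟩ := q
    cases b <;> cases d <;> simp [hq, eq_comm]
  simp only [key]
  rw [← Finset.add_sum_erase _ _ (Finset.mem_univ (q.1, !q.2)), if_pos rfl,
    Finset.sum_congr rfl fun p hp => if_neg (Finset.ne_of_mem_erase hp), Finset.sum_const,
    Finset.card_erase_of_mem (Finset.mem_univ _), Finset.card_univ, Fintype.card_prod,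
    Fintype.card_bool, mul_comm]

/-- The radial function `w ↦ φ(|w|)` with `φ(n) = (5 iⁿ + 3 (-i/3)ⁿ) / 8`, which is bounded on the
free group with two generators, and an eigenfunction of the sum of the four translations by
generators and their inverses for the eigenvalue `2 i`. -/
def radialEigenfunction (w : FreeGroup (Fin 2)) : ℂ :=
  (5 * Complex.I ^ w.norm + 3 * (-Complex.I / 3) ^ w.norm) / 8

theorem norm_radialEigenfunction_le (w : FreeGroup (Fin 2)) : ‖radialEigenfunction w‖ ≤ 1 := by
  rw [radialEigenfunction, norm_div, div_le_one (by simp)]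
  refine (norm_add_le _ _).trans ?_
  have h : ((1 : ℝ) / 3) ^ w.norm ≤ 1 := pow_le_one₀ (by norm_num) (by norm_num)
  simp only [norm_mul, norm_pow, norm_div, norm_neg, Complex.norm_I, Complex.norm_ofNat, one_pow]
  linarith

/-- Away from the identity, a radial eigenfunction for `z` solves `φ(n - 1) + 3 φ(n + 1) = z φ(n)`,
with characteristic equation `3 x² - z x + 1 = 0`. For `z = 2i` the roots are `i` and `-i/3`, both
of modulus at most 1, whence boundedness. The condition `4 φ(1) = z φ(0)` at the identity and `φ(0)
= 1` force the weights `5/8` and `3/8`. -/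
theorem sum_radialEigenfunction_mul (w : FreeGroup (Fin 2)) :
    ∑ p : Fin 2 × Bool, radialEigenfunction (w * mk [p]) =
      2 * Complex.I * radialEigenfunction w := by
  -- Right multiplication is needed for the eigenform, while cancellation is read off at the head of
  -- a word. Inversion preserves length and permutes the four letters, so it exchanges the two
  -- sides.
  have hinv : ∑ p : Fin 2 × Bool, radialEigenfunction (w * mk [p]) =
      ∑ p : Fin 2 × Bool, radialEigenfunction (mk [p] * w⁻¹) := by
    refine Fintype.sum_equiv ((Equiv.refl _).prodCongr Equiv.boolNot) _ _ fun p => ?_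
    rw [radialEigenfunction, radialEigenfunction, ← norm_inv_eq, mul_inv_rev, inv_mk]
    rfl
  have hI := Complex.I_mul_I
  rw [hinv]
  by_cases hw : w = 1
  · subst hw
    simp only [radialEigenfunction, norm_mk_singleton_mul, inv_one, toWord_one, List.head?_nil,
      reduceCtorEq, if_false, norm_one, Finset.sum_const, Finset.card_univ, Fintype.card_prod,
      Fintype.card_bool, Fintype.card_fin, nsmul_eq_mul, pow_zero, pow_one, zero_add]
    push_cast
    ring
  · have h := sum_radial_mk_singleton_mul
      (fun n => (5 * Complex.I ^ n + 3 * (-Complex.I / 3) ^ n) / 8) w⁻¹ (inv_ne_one.2 hw)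
    refine h.trans ?_
    obtain ⟨n, hn⟩ := Nat.exists_eq_succ_of_ne_zero (mt norm_eq_zero.1 hw)
    rw [norm_inv_eq, radialEigenfunction, hn, Fintype.card_fin]
    simp only [Nat.succ_eq_add_one, Nat.add_sub_cancel, pow_succ, nsmul_eq_mul]
    push_cast
    linear_combination (5 / 8 * Complex.I ^ n + 3 / 8 * (-Complex.I / 3) ^ n) * hI

end FreeGroup

/-! ### The free group on two generators -/

/-- The sum of the elements `λ(a) ⊗ λ(a)` of `C*_r(F₂) ⊗_γ C*_r(F₂)`, where `a` runs over the
generators and their inverses. -/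
def ReducedCStar.diagonalLaplacian :
    ProjectiveTensor (ReducedCStar (FreeGroup (Fin 2))) (ReducedCStar (FreeGroup (Fin 2))) :=
  ∑ p : Fin 2 × Bool, ProjectiveTensor.tmul (of (FreeGroup.mk [p])) (of (FreeGroup.mk [p]))

/-- The sum of the generators of `F₂` and their inverses as an element of `ℓ¹(F₂)`. -/
def GroupL1.laplacian : GroupL1 (FreeGroup (Fin 2)) :=
  ∑ p : Fin 2 × Bool, delta (FreeGroup.mk [p])

theorem FreeGroup.sum_inv_mk_singleton {M : Type*} [AddCommMonoid M] (u : FreeGroup (Fin 2) → M) :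
    ∑ p : Fin 2 × Bool, u (FreeGroup.mk [p])⁻¹ = ∑ p : Fin 2 × Bool, u (FreeGroup.mk [p]) := by
  refine Fintype.sum_equiv ((Equiv.refl _).prodCongr Equiv.boolNot) _ _ fun p => ?_
  rw [inv_mk]
  rfl

theorem GroupL1.star_laplacian : star laplacian = laplacian := by
  rw [laplacian, star_sum]
  simp only [star_delta]
  exact FreeGroup.sum_inv_mk_singleton _

namespace ReducedCStar

theorem star_diagonalLaplacian : star diagonalLaplacian = diagonalLaplacian := by
  rw [diagonalLaplacian, star_sum]
  simp only [star_tmul_of]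
  exact FreeGroup.sum_inv_mk_singleton
    fun s => (ProjectiveTensor.tmul (of s) (of s) :
      ProjectiveTensor (ReducedCStar (FreeGroup (Fin 2))) (ReducedCStar (FreeGroup (Fin 2))))

theorem diagonal_laplacian :
    diagonal (FreeGroup (Fin 2)) GroupL1.laplacian = diagonalLaplacian := by
  rw [GroupL1.laplacian, map_sum, diagonalLaplacian]
  exact Finset.sum_congr rfl fun p _ => GroupL1.liftHom_delta _ _ _ _ _

/-- The linear form on `C*_r(F₂) ⊗_γ C*_r(F₂)` given by the radial eigenfunction. -/
def radialForm :
    ProjectiveTensor (ReducedCStar (FreeGroup (Fin 2))) (ReducedCStar (FreeGroup (Fin 2))) →L[ℂ] ℂ :=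
  diagForm FreeGroup.radialEigenfunction FreeGroup.norm_radialEigenfunction_le

theorem radialForm_mul (t) :
    radialForm (t * diagonalLaplacian) = 2 * Complex.I * radialForm t :=
  diagForm_mul_sum _ _ _ _ FreeGroup.sum_radialEigenfunction_mul t

/-- This is the eigenvalue equation at the identity, where the eigenfunction is `1`; it supplies the
nonvanishing of the eigenform at the element itself. -/
theorem radialForm_diagonalLaplacian : radialForm diagonalLaplacian = 2 * Complex.I := by
  have h := FreeGroup.sum_radialEigenfunction_mul 1
  simp only [one_mul] at h
  rw [diagonalLaplacian, map_sum]
  simp only [radialForm, diagForm_of]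
  rw [h, FreeGroup.radialEigenfunction, FreeGroup.norm_one]
  norm_num

end ReducedCStar

theorem two_mul_I_sq_ne_ofReal (r : ℝ) (hr : 0 ≤ r) : (2 * Complex.I) ^ 2 ≠ (r : ℂ) := by
  rw [mul_pow, Complex.I_sq]
  intro h
  have h' : (2 : ℝ) ^ 2 * -1 = r := by exact_mod_cast h
  linarith

theorem not_isSymmetricStarAlgebra_projectiveTensor_freeGroup : ¬ IsSymmetricStarAlgebra
    (ProjectiveTensor (ReducedCStar (FreeGroup (Fin 2))) (ReducedCStar (FreeGroup (Fin 2)))) :=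
  not_isSymmetricStarAlgebra_of_eigenform _ ReducedCStar.star_diagonalLaplacian
    ReducedCStar.radialForm.toLinearMap (2 * Complex.I) ReducedCStar.radialForm_mul
    (by
      rw [ContinuousLinearMap.coe_coe, ReducedCStar.radialForm_diagonalLaplacian]
      simp)
    two_mul_I_sq_ne_ofReal

theorem not_isSymmetricStarAlgebra_groupL1_freeGroup :
    ¬ IsSymmetricStarAlgebra (GroupL1 (FreeGroup (Fin 2))) := by
  -- The eigenform pulls back along the diagonal map, which is multiplicative and carries
  -- `laplacian` to `diagonalLaplacian`.
  let Φ : GroupL1 (FreeGroup (Fin 2)) →ₗ[ℂ] ℂ :=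
    ReducedCStar.radialForm.toLinearMap ∘ₗ
      { toFun := ReducedCStar.diagonal (FreeGroup (Fin 2))
        map_add' := map_add _
        map_smul' := map_smul _ }
  have hΦ (g) : Φ g = ReducedCStar.radialForm (ReducedCStar.diagonal _ g) := rfl
  refine not_isSymmetricStarAlgebra_of_eigenform _ GroupL1.star_laplacian Φ (2 * Complex.I)
    (fun g => ?_) ?_ two_mul_I_sq_ne_ofReal
  · rw [hΦ, hΦ, map_mul, ReducedCStar.diagonal_laplacian, ReducedCStar.radialForm_mul]
  · rw [hΦ, ReducedCStar.diagonal_laplacian, ReducedCStar.radialForm_diagonalLaplacian]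
    simp

end

theorem mainTheorem8 :
    -- the diagonal embedding of `ℓ¹(F₂)` is a well defined isometric `*`-homomorphism
    (∃ Δ : GroupL1 (FreeGroup (Fin 2)) →⋆ₙₐ[ℂ]
        ProjectiveTensor (ReducedCStar (FreeGroup (Fin 2))) (ReducedCStar (FreeGroup (Fin 2))),
      (∀ f : GroupL1 (FreeGroup (Fin 2)),
        HasSum (fun s : FreeGroup (Fin 2) =>
          f s • ProjectiveTensor.tmul (ReducedCStar.of s) (ReducedCStar.of s)) (Δ f)) ∧
      Isometry Δ) ∧
    ¬ IsSymmetricStarAlgebra (GroupL1 (FreeGroup (Fin 2))) ∧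
    ¬ IsSymmetricStarAlgebra
        (ProjectiveTensor (ReducedCStar (FreeGroup (Fin 2))) (ReducedCStar (FreeGroup (Fin 2)))) ∧
    IsSymmetricStarAlgebra (ReducedCStar (FreeGroup (Fin 2))) ∧
    ¬ IsRigidlySymmetric.{0, 0} (ReducedCStar (FreeGroup (Fin 2))) :=
  ⟨⟨ReducedCStar.diagonal _, ReducedCStar.hasSum_diagonal, ReducedCStar.isometry_diagonal⟩,
    not_isSymmetricStarAlgebra_groupL1_freeGroup,
    not_isSymmetricStarAlgebra_projectiveTensor_freeGroup,
    CStarAlgebra.isSymmetricStarAlgebra _,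
    -- The C*-algebra to test against is `C*_r(F₂)` itself.
    fun h => not_isSymmetricStarAlgebra_projectiveTensor_freeGroup (h _)⟩
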